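/- Let $\mathcal C\subset\mathbb C^3$ be an irreducible algebraic curve, and let $B$ be an infinity branch of $\mathcal C$ associated to a point at infinity $(1:m_2:m_3:0)$. That is, there are Puiseux series $\varphi_k(t)=\sum_q a_{q,k}t^{q}$ ($k=2,3$) with exponents in $\tfrac1N\mathbb Z_{\ge 0}$, with $N\ge 1$ least such for the pair, which converge for $|t|<1/M$ for some $M>0$, such that, with $r_k(z)=z\varphi_k(1/z)=m_kz+\cdots$, $$B=\{(z,r_2(z),r_3(z)) : z\in\mathbb C,\ |z|>M\}\subset\mathcal C ,$$ where $B$ comprises the leaves obtained from all $N$ conjugates of $(\varphi_2,\varphi_3)$, i.e. by replacing $t^{1/N}$ by $\epsilon t^{1/N}$ with $\epsilon^N=1$. Let $\tilde r_k(z)$ be obtained from $r_k(z)$ by deleting all terms with negative exponent, let $n_k\ge 1$ be the least common denominator of the exponents occurring in $\tilde r_k$, and let $\deg(B):=n:=\operatorname{lcm}(n_2,n_3)$. For $\widetilde M>0$ let $\widetilde B=\{(z,\tilde r_2(z),\tilde r_3(z)) : |z|>\widetilde M\}$, again with all its conjugate leaves. Then there is exactly one irreducible algebraic curve $\widetilde{\mathcal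 C}\subset\mathbb C^3$ containing $\widetilde B$. The polynomial triple $\widetilde{\mathcal Q}(t)=(t^n,\tilde r_2(t^n),\tilde r_3(t^n))\in\mathbb C[t]^3$, in which $(t^n)^{i/n}$ is read as $t^i$, is a parametrization of $\widetilde{\mathcal C}$ (its values lie on $\widetilde{\mathcal C}$ and reach all but finitely many of its points). It is proper (it has a rational inverse), and the maximal degree of its components is $n$. Moreover $$\deg(\widetilde{\mathcal C})=\deg(B),$$ where the degree of a space curve is the number of its points on a generic plane, i.e. on every plane $a_0+a_1x_1+a_2x_2+a_3x_3=0$ whose coefficient vector lies outside the zero set of some fixed nonzero polynomial in $a_0,\dots,a_3$. -/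

import Mathlib

noncomputable section

namespace SpaceAsymptote

/-- Puiseux series of nonnegative order `φ(t) = ∑ q, coeff q * t ^ q` over `ℂ`: all exponents are
nonnegative rationals with a common denominator. -/
@[ext] structure PuiseuxSeries where
  coeff : ℚ → ℂ
  exists_ramification : ∃ N : ℕ, 0 < N ∧ ∀ q, coeff q ≠ 0 → ∃ i : ℕ, q = i / N

namespace PuiseuxSeries

open Classical in
/-- The ramification index: the least common denominator of the exponents. Writing the exponents
as `N_i / N` with a common denominator `N`, being least means `gcd (N, N_1, N_2, …) = 1`. -/
def ramificationIndex (φ : PuiseuxSeries) : ℕ := Nat.find φ.exists_ramification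

/-- Remove from `φ` the terms of exponent `q > 1`. As the term `t ^ q` of `φ` gives the term
`z ^ (1 - q)` of `r(z) = z * φ(1/z)`, this removes from `r` the terms of negative exponent. -/
def trunc (φ : PuiseuxSeries) : PuiseuxSeries where
  coeff q := if q ≤ 1 then φ.coeff q else 0
  exists_ramification := by
    obtain ⟨N, hN, h⟩ := φ.exists_ramification
    exact ⟨N, hN, fun q hq => h q fun h0 => hq (by simp [h0])⟩

/-- The value `∑ i, a_i * s ^ i` of `φ = ∑ i, a_i * t ^ (i / N)`, where `s` is the chosen value of
`t ^ (1 / N)` and `N` is a common denominator of the exponents. -/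
def value (φ : PuiseuxSeries) (N : ℕ) (s : ℂ) : ℂ :=
  ∑' i : ℕ, φ.coeff ((i : ℚ) / N) * s ^ i

end PuiseuxSeries

/-- The ramification index `N = lcm (N₂, N₃)` of a pair of Puiseux series. -/
def pairIndex (φ₂ φ₃ : PuiseuxSeries) : ℕ :=
  Nat.lcm φ₂.ramificationIndex φ₃.ramificationIndex

/-- The leaf `{(z, r₂(z), r₃(z)) : |z| > M}`, `r_k(z) = z * σ_ε(φ_k)(1/z)`, of the conjugate
`σ_ε(φ₂, φ₃)` obtained by replacing `t ^ (1 / N)` by `ε * t ^ (1 / N)`, where `ε ^ N = 1`. -/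
def leaf (φ₂ φ₃ : PuiseuxSeries) (M : ℝ) (ε : ℂ) : Set (Fin 3 → ℂ) :=
  {p | ∃ z : ℂ, M < ‖z‖ ∧
    p = ![z,
      z * φ₂.value (pairIndex φ₂ φ₃) (ε * z⁻¹ ^ ((pairIndex φ₂ φ₃ : ℂ)⁻¹)),
      z * φ₃.value (pairIndex φ₂ φ₃) (ε * z⁻¹ ^ ((pairIndex φ₂ φ₃ : ℂ)⁻¹))]}

/-- The union of the `N` conjugate leaves. -/
def leaves (φ₂ φ₃ : PuiseuxSeries) (M : ℝ) : Set (Fin 3 → ℂ) :=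
  ⋃ ε ∈ {ε : ℂ | ε ^ pairIndex φ₂ φ₃ = 1}, leaf φ₂ φ₃ M ε

/-- An irreducible algebraic curve in `ℂ³`: the zero set of a prime ideal of dimension one. -/
def IsIrreducibleCurve (C : Set (Fin 3 → ℂ)) : Prop :=
  ∃ P : Ideal (MvPolynomial (Fin 3) ℂ), P.IsPrime ∧
    ringKrullDim (MvPolynomial (Fin 3) ℂ ⧸ P) = 1 ∧ C = MvPolynomial.zeroLocus ℂ P

/-- The degree of a space curve: the number of its intersection points with a generic plane
`a₀ + a₁ x₁ + a₂ x₂ + a₃ x₃ = 0`, that is, with every plane outside the zero set of some nonzero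
polynomial in `a₀, a₁, a₂, a₃`. -/
def HasDegree (C : Set (Fin 3 → ℂ)) (d : ℕ) : Prop :=
  ∃ G : MvPolynomial (Fin 4) ℂ, G ≠ 0 ∧ ∀ a : Fin 4 → ℂ, MvPolynomial.eval a G ≠ 0 →
    {p ∈ C | a 0 + a 1 * p 0 + a 2 * p 1 + a 3 * p 2 = 0}.encard = d

/-- An infinity branch of `C` associated to an infinity point `(1 : m₂ : m₃ : 0)`, where `m_k` is
the constant coefficient of `φ_k`. -/
structure InfinityBranch (C : Set (Fin 3 → ℂ)) where
  φ₂ : PuiseuxSeries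
  φ₃ : PuiseuxSeries
  M : ℝ
  M_pos : 0 < M
  summable₂ : ∀ s : ℂ, ‖s‖ ^ pairIndex φ₂ φ₃ < M⁻¹ →
    Summable fun i : ℕ => φ₂.coeff ((i : ℚ) / pairIndex φ₂ φ₃) * s ^ i
  summable₃ : ∀ s : ℂ, ‖s‖ ^ pairIndex φ₂ φ₃ < M⁻¹ →
    Summable fun i : ℕ => φ₃.coeff ((i : ℚ) / pairIndex φ₂ φ₃) * s ^ i
  subset : leaves φ₂ φ₃ M ⊆ C

namespace InfinityBranch

variable {C : Set (Fin 3 → ℂ)}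

/-- The degree `n = lcm (n₂, n₃)` of a branch, where `n_k` is the least common denominator of the
nonnegative exponents of `r_k`. -/
def degree (B : InfinityBranch C) : ℕ := pairIndex B.φ₂.trunc B.φ₃.trunc

/-- The truncated branch `{(z, r̃₂(z), r̃₃(z)) : |z| > M'}` (with all its conjugate leaves). -/
def truncated (B : InfinityBranch C) (M' : ℝ) : Set (Fin 3 → ℂ) :=
  leaves B.φ₂.trunc B.φ₃.trunc M'

/-- The polynomial `r̃(t ^ n)`, where `r̃` is the truncation of `r(z) = z * φ(1/z)`: the term
`a * z ^ (1 - j / n)` of `r̃` becomes `a * t ^ (n - j)`. -/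
def truncPoly (φ : PuiseuxSeries) (n : ℕ) : Polynomial ℂ :=
  ∑ j ∈ Finset.range (n + 1), Polynomial.monomial (n - j) (φ.coeff ((j : ℚ) / n))

/-- The triple of polynomials `(t ^ n, r̃₂(t ^ n), r̃₃(t ^ n))`, `n = deg B`. -/
def param (B : InfinityBranch C) : Fin 3 → Polynomial ℂ :=
  ![Polynomial.X ^ B.degree, truncPoly B.φ₂ B.degree, truncPoly B.φ₃ B.degree]

end InfinityBranch

/-- `q` is a polynomial parametrization of the curve `C`: its values lie on `C` and it reaches all
but finitely many points of `C`. -/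
def IsParametrization (q : Fin 3 → Polynomial ℂ) (C : Set (Fin 3 → ℂ)) : Prop :=
  (∀ t : ℂ, (fun k => (q k).eval t) ∈ C) ∧
    (C \ Set.range fun t : ℂ => fun k => (q k).eval t).Finite

/-- `q` is proper: it has a rational inverse `u / v`, that is, `(u / v)(q(t)) = t`. -/
def IsProperParam (q : Fin 3 → Polynomial ℂ) : Prop :=
  ∃ u v : MvPolynomial (Fin 3) ℂ, MvPolynomial.aeval q v ≠ 0 ∧
    MvPolynomial.aeval q u = Polynomial.X * MvPolynomial.aeval q v

/-- The degree of a polynomial parametrization: the maximal degree of its components. -/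
def paramDegree (q : Fin 3 → Polynomial ℂ) : ℕ := Finset.univ.sup fun k => (q k).natDegree

end SpaceAsymptote

end

section

open Polynomial

/-! For `z = t ^ n`, the truncated branch with all its leaves is the part `|t ^ n| > M'` of the
image of the polynomial triple `Q(t)`. Since `t` is a root of the monic `T ^ n - x₁`, `ℂ[t]` is
integral over the coordinate ring of that image. Hence the image is closed, irreducible and
one-dimensional (`zeroLocus_ker_aeval`, `ringKrullDim_quotient_ker_aeval`), and an irreducible curve
containing `Q(t)` for infinitely many `t` equals it (`eq_polyCurve_of_infinite`).

`Q` is proper because `n` is a least common denominator: a nontrivial substitution `t ↦ ε t` fixing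
`Q` would lower it (`isProperParam_of_comp_eq`). Properness matches the points on a generic plane
with the `n` simple roots of a polynomial in `t` (`hasDegree_polyCurve`). -/

/-! ### Rings of dimension one -/

theorem ringKrullDim_eq_one_of_isIntegral_principal (A S : Type*) [CommRing A] [IsDomain A]
    [CommRing S] [IsDomain S] [IsPrincipalIdealRing S] [Algebra A S] [FaithfulSMul A S]
    [Algebra.IsIntegral A S] (h : ¬ IsField S) : ringKrullDim A = 1 := by
  have hinj := FaithfulSMul.algebraMap_injective A S
  refine eq_of_le_of_not_lt ?_ fun h' ↦ h ?_
  · rw [← Nat.cast_one, ← Ring.krullDimLE_iff, Ring.krullDimLE_one_iff_of_noZeroDivisors]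
    intro I hI hI'
    -- Lying over: a nonzero prime of `A` lies below a nonzero, hence maximal, prime of `S`.
    obtain ⟨Q, -, hQ, rfl⟩ := Ideal.exists_ideal_over_prime_of_isIntegral I (⊥ : Ideal S)
      (by rw [← RingHom.ker_eq_comap_bot, (RingHom.injective_iff_ker_eq_bot _).mp hinj]
          exact bot_le)
    have hQ0 : Q ≠ ⊥ := by
      rintro rfl
      exact hI (by rw [← RingHom.ker_eq_comap_bot, (RingHom.injective_iff_ker_eq_bot _).mp hinj])
    have := IsPrime.to_maximal_ideal hQ0
    exact Ideal.isMaximal_comap_of_isIntegral_of_isMaximal Q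
  · have h'' : ringKrullDim A ≤ 0 := Order.le_of_lt_succ h'
    rw [← Nat.cast_zero, ← Ring.krullDimLE_iff] at h''
    exact isField_of_isIntegral_of_isField' (R := A) Ring.KrullDimLE.isField_of_isDomain

/-- Killing a nonzero element of the domain `R ⧸ P` lowers the dimension by at least one. -/
theorem Ideal.eq_of_le_of_ringKrullDim_quotient_eq_one {R : Type*} [CommRing R] {P Q : Ideal R}
    [P.IsPrime] (hPQ : P ≤ Q) (hP : ringKrullDim (R ⧸ P) = 1) (hQ : ringKrullDim (R ⧸ Q) = 1) :
    P = Q := by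
  refine le_antisymm hPQ fun r hr ↦ ?_
  by_contra hrP
  have := ringKrullDim_succ_le_of_surjective (Ideal.Quotient.factor hPQ)
    (Ideal.Quotient.factor_surjective hPQ) (r := Ideal.Quotient.mk P r)
    (mem_nonZeroDivisors_of_ne_zero (by rwa [Ne, Ideal.Quotient.eq_zero_iff_mem]))
    (by simpa [Ideal.Quotient.eq_zero_iff_mem] using hr)
  rw [hP, hQ] at this
  exact absurd this (by decide)

namespace SpaceAsymptote

/-! ### Polynomial curves as irreducible algebraic curves -/

/-- The curve traced out by a triple of polynomials. -/
def polyCurve (q : Fin 3 → ℂ[X]) : Set (Fin 3 → ℂ) := Set.range fun t : ℂ => fun k => (q k).eval t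

theorem eval_aeval_triple (q : Fin 3 → ℂ[X]) (t : ℂ) (f : MvPolynomial (Fin 3) ℂ) :
    (MvPolynomial.aeval q f).eval t = MvPolynomial.aeval (fun k => (q k).eval t) f := by
  have := MvPolynomial.comp_aeval_apply (f := q) (Polynomial.aeval (R := ℂ) t) f
  simpa [Polynomial.coe_aeval_eq_eval] using this

theorem isIntegral_aeval_triple {q : Fin 3 → ℂ[X]} {n : ℕ} (hn : 0 < n) (h0 : q 0 = X ^ n) :
    (MvPolynomial.aeval (R := ℂ) q).toRingHom.IsIntegral := by
  set φ := (MvPolynomial.aeval (R := ℂ) q).toRingHom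
  have hC : ∀ c : ℂ, φ.IsIntegralElem (C c) := fun c ↦ by
    have : φ (MvPolynomial.C c) = C c := by simp [φ]
    rw [← this]; exact φ.isIntegralElem_map
  have hX : φ.IsIntegralElem X := by
    refine ⟨X ^ n - C (MvPolynomial.X 0), monic_X_pow_sub_C _ hn.ne', ?_⟩
    simp [φ, h0]
  intro p
  induction p using Polynomial.induction_on' with
  | add p r hp hr => exact hp.add φ hr
  | monomial k a =>
    rw [← C_mul_X_pow_eq_monomial]
    refine (hC a).mul φ ?_
    induction k with
    | zero => simpa using hC 1
    | succ k ih => rw [pow_succ]; exact ih.mul φ hX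

/-- No point of the closure is missed, by integrality: a prime of `ℂ[X]` over the maximal ideal of
`x` has a generator with a root, and that root is a parameter of `x`. -/
theorem zeroLocus_ker_aeval {q : Fin 3 → ℂ[X]} {n : ℕ} (hn : 0 < n) (h0 : q 0 = X ^ n) :
    MvPolynomial.zeroLocus ℂ (RingHom.ker (MvPolynomial.aeval (R := ℂ) q)) = polyCurve q := by
  ext x
  constructor
  · intro hx
    let := (MvPolynomial.aeval (R := ℂ) q).toRingHom.toAlgebra
    have : Algebra.IsIntegral (MvPolynomial (Fin 3) ℂ) ℂ[X] := ⟨isIntegral_aeval_triple hn h0⟩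
    have : (RingHom.ker (MvPolynomial.aeval (R := ℂ) x)).IsPrime := RingHom.ker_isPrime _
    obtain ⟨Q, -, hQ, hQx⟩ := Ideal.exists_ideal_over_prime_of_isIntegral
      (RingHom.ker (MvPolynomial.aeval (R := ℂ) x)) (⊥ : Ideal ℂ[X])
      (fun p hp ↦ hx p hp)
    obtain ⟨g, rfl⟩ := (IsPrincipalIdealRing.principal Q).principal
    obtain ⟨t, ht⟩ : ∃ t, g.IsRoot t := by
      refine IsAlgClosed.exists_root g fun hg ↦ hQ.ne_top ?_
      exact Ideal.span_singleton_eq_top.2 (isUnit_iff_degree_eq_zero.2 hg)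
    refine ⟨t, funext fun k ↦ ?_⟩
    have hk : (MvPolynomial.X k - MvPolynomial.C (x k) : MvPolynomial (Fin 3) ℂ) ∈
        RingHom.ker (MvPolynomial.aeval (R := ℂ) x) := by simp [RingHom.mem_ker]
    rw [← hQx, Ideal.mem_comap] at hk
    obtain ⟨w, hw⟩ := Ideal.mem_span_singleton.1 hk
    have hw' : q k - C (x k) = g * w := by
      rw [← hw]
      change _ = MvPolynomial.aeval q _
      simp
    have := congrArg (Polynomial.eval t) hw'
    rw [eval_mul, ht.eq_zero, zero_mul] at this
    simpa [sub_eq_zero] using this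
  · rintro ⟨t, rfl⟩ p hp
    rw [← eval_aeval_triple, (RingHom.mem_ker).1 hp, eval_zero]

theorem ringKrullDim_quotient_ker_aeval {q : Fin 3 → ℂ[X]} {n : ℕ} (hn : 0 < n)
    (h0 : q 0 = X ^ n) : ringKrullDim (MvPolynomial (Fin 3) ℂ ⧸
      RingHom.ker (MvPolynomial.aeval (R := ℂ) q)) = 1 := by
  set φ := (MvPolynomial.aeval (R := ℂ) q).toRingHom
  change ringKrullDim (_ ⧸ RingHom.ker φ) = 1
  have : (RingHom.ker φ).IsPrime := RingHom.ker_isPrime _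
  let := (RingHom.kerLift φ).toAlgebra
  have : FaithfulSMul (MvPolynomial (Fin 3) ℂ ⧸ RingHom.ker φ) ℂ[X] :=
    (faithfulSMul_iff_algebraMap_injective _ _).2 (RingHom.kerLift_injective φ)
  have : Algebra.IsIntegral (MvPolynomial (Fin 3) ℂ ⧸ RingHom.ker φ) ℂ[X] := by
    refine ⟨RingHom.IsIntegral.tower_top (Ideal.Quotient.mk (RingHom.ker φ)) _ ?_⟩
    exact isIntegral_aeval_triple hn h0
  exact ringKrullDim_eq_one_of_isIntegral_principal _ ℂ[X] (Polynomial.not_isField ℂ)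

theorem isIrreducibleCurve_polyCurve {q : Fin 3 → ℂ[X]} {n : ℕ} (hn : 0 < n) (h0 : q 0 = X ^ n) :
    IsIrreducibleCurve (polyCurve q) :=
  ⟨_, RingHom.ker_isPrime _, ringKrullDim_quotient_ker_aeval hn h0, (zeroLocus_ker_aeval hn h0).symm⟩

/-- An irreducible curve that contains infinitely many points of a polynomial curve, counted with
parameters, is that polynomial curve. -/
theorem eq_polyCurve_of_infinite {q : Fin 3 → ℂ[X]} {n : ℕ} (hn : 0 < n) (h0 : q 0 = X ^ n)
    {D : Set (Fin 3 → ℂ)} (hD : IsIrreducibleCurve D)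
    (hinf : {t : ℂ | (fun k => (q k).eval t) ∈ D}.Infinite) : D = polyCurve q := by
  obtain ⟨P, hP, hdim, rfl⟩ := hD
  rw [← zeroLocus_ker_aeval hn h0]
  congr 1
  refine Ideal.eq_of_le_of_ringKrullDim_quotient_eq_one (fun f hf ↦ ?_) hdim
    (ringKrullDim_quotient_ker_aeval hn h0)
  refine (RingHom.mem_ker).2 (Polynomial.eq_zero_of_infinite_isRoot _ (hinf.mono fun t ht ↦ ?_))
  change Polynomial.eval t _ = 0
  rw [eval_aeval_triple]
  exact ht f hf

/-! ### Properness -/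

-- Let `K = ℂ(q)` inside `ℂ(t)`. A conjugate of `t` over `K` is a root of `T ^ n - t ^ n`, so it is
-- `ε t`; it is also a root of each `q_k(T) - q_k(t)`, so `ε` fixes `q` and equals `1`. By
-- separability `t` has degree one over `K`, and `t ∈ K` is the rational inverse.
open Classical in
theorem isProperParam_of_comp_eq {q : Fin 3 → ℂ[X]} {n : ℕ} (hn : 0 < n) (h0 : q 0 = X ^ n)
    (hq : ∀ ε : ℂ, ε ^ n = 1 → (∀ k, (q k).comp (C ε * X) = q k) → ε = 1) : IsProperParam q := by
  let ι : ℂ[X] →ₐ[ℂ] RatFunc ℂ := IsScalarTower.toAlgHom ℂ ℂ[X] (RatFunc ℂ)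
  have hι : Function.Injective ι := RatFunc.algebraMap_injective ℂ
  let x : RatFunc ℂ := ι X
  have hx0 : x ≠ 0 := fun h ↦ X_ne_zero (hι (h.trans (map_zero ι).symm))
  have hιp : ∀ p r : ℂ[X], Polynomial.aeval (ι r) p = ι (p.comp r) := fun p r ↦ by
    rw [Polynomial.aeval_algHom_apply, comp_eq_aeval]
  let K := IntermediateField.adjoin ℂ (Set.range fun k => ι (q k))
  have hmem : ∀ k, ι (q k) ∈ K := fun k ↦ IntermediateField.subset_adjoin _ _ ⟨k, rfl⟩
  let y : Fin 3 → K := fun k ↦ ⟨ι (q k), hmem k⟩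
  have hyx : ∀ k, Polynomial.aeval x ((q k).map (algebraMap ℂ K) - C (y k)) = 0 := fun k ↦ by
    rw [map_sub, Polynomial.aeval_map_algebraMap, hιp, comp_X, aeval_C]
    exact sub_self _
  have hint : IsIntegral K x := by
    refine ⟨X ^ n - C (y 0), monic_X_pow_sub_C _ hn.ne', ?_⟩
    have := hyx 0
    rwa [h0, Polynomial.map_pow, Polynomial.map_X] at this
  set f := minpoly K x with hf
  have hroot : ∀ β : RatFunc ℂ, Polynomial.aeval β f = 0 → β = x := by
    intro β hβ
    have hβk : ∀ k, Polynomial.aeval β (q k) = ι (q k) := fun k ↦ by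
      obtain ⟨g, hg⟩ := minpoly.dvd K x (hyx k)
      have := congrArg (Polynomial.aeval β) hg
      rw [map_mul, hβ, zero_mul, map_sub, Polynomial.aeval_map_algebraMap, aeval_C] at this
      exact sub_eq_zero.1 this
    have hpow : (β / x) ^ n = 1 := by
      have := hβk 0
      rw [h0, map_pow, map_pow, aeval_X] at this
      rw [div_pow, this, div_self (pow_ne_zero _ hx0)]
    have : NeZero n := ⟨hn.ne'⟩
    have hζ : IsPrimitiveRoot (algebraMap ℂ (RatFunc ℂ) (Complex.exp (2 * Real.pi * Complex.I / n))) n :=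
      (Complex.isPrimitiveRoot_exp n hn.ne').map_of_injective (algebraMap ℂ (RatFunc ℂ)).injective
    obtain ⟨i, -, hi⟩ := hζ.eq_pow_of_pow_eq_one hpow
    set ε := Complex.exp (2 * Real.pi * Complex.I / n) ^ i
    have hεn : ε ^ n = 1 := by
      rw [← pow_mul, mul_comm i n, pow_mul, (Complex.isPrimitiveRoot_exp n hn.ne').pow_eq_one, one_pow]
    have hβx : β = ι (C ε * X) := by
      have h1 : ι (C ε) = algebraMap ℂ (RatFunc ℂ) ε := ι.commutes ε
      rw [map_mul, h1, map_pow, hi, div_mul_cancel₀ _ hx0]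
    have hε : ε = 1 := hq ε hεn fun k ↦ hι (by rw [← hιp, ← hβx, hβk])
    rw [hβx, hε, C_1, one_mul]
  have hsplit : (f.map (algebraMap K (RatFunc ℂ))).Splits := by
    have : NeZero n := ⟨hn.ne'⟩
    have hζ := (Complex.isPrimitiveRoot_exp n hn.ne').map_of_injective
      (algebraMap ℂ (RatFunc ℂ)).injective
    have h1 : (X ^ n - C (x ^ n) : (RatFunc ℂ)[X]).Splits := X_pow_sub_C_splits_of_isPrimitiveRoot hζ rfl
    refine h1.of_dvd (X_pow_sub_C_ne_zero hn _) ?_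
    have h2 : f ∣ X ^ n - C (y 0) := by
      have := minpoly.dvd K x (hyx 0)
      rwa [h0, Polynomial.map_pow, Polynomial.map_X] at this
    have h3 := Polynomial.map_dvd (algebraMap K (RatFunc ℂ)) h2
    have h4 : algebraMap K (RatFunc ℂ) (y 0) = x ^ n := by
      change ι (q 0) = _
      rw [h0, map_pow]
    rwa [Polynomial.map_sub, Polynomial.map_pow, Polynomial.map_X, map_C, h4] at h3
  have hsep : (f.map (algebraMap K (RatFunc ℂ))).Separable :=
    ((minpoly.irreducible hint).separable).map
  have hdeg : f.natDegree ≤ 1 := by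
    rw [← Polynomial.natDegree_map (algebraMap K (RatFunc ℂ)), hsplit.natDegree_eq_card_roots,
      ← Multiset.toFinset_card_of_nodup (nodup_roots hsep), Finset.card_le_one]
    have : ∀ a ∈ (f.map (algebraMap K (RatFunc ℂ))).roots.toFinset, a = x := fun a ha ↦ by
      rw [Multiset.mem_toFinset] at ha
      have := (mem_roots'.1 ha).2
      rw [IsRoot, eval_map_algebraMap] at this
      exact hroot a this
    intro a ha b hb
    rw [this a ha, this b hb]
  have hxK : x ∈ K := by
    have h1 : f.degree = 1 := by
      refine (degree_eq_iff_natDegree_eq_of_pos one_pos).2 ?_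
      exact le_antisymm hdeg (minpoly.natDegree_pos hint)
    obtain ⟨z, hz⟩ := minpoly.mem_range_of_degree_eq_one K x h1
    rw [← hz]
    exact z.2
  obtain ⟨r, s, hrs⟩ := (IntermediateField.mem_adjoin_range_iff ℂ _ _).1 hxK
  have hev : ∀ g : MvPolynomial (Fin 3) ℂ,
      MvPolynomial.aeval (fun k => ι (q k)) g = ι (MvPolynomial.aeval q g) := fun g ↦ by
    rw [← MvPolynomial.comp_aeval_apply]
  rw [hev, hev] at hrs
  have hs : ι (MvPolynomial.aeval q s) ≠ 0 := fun h ↦ hx0 (by rw [hrs, h, div_zero])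
  refine ⟨r, s, fun h ↦ hs (by rw [h, map_zero]), hι ?_⟩
  rw [map_mul]
  change _ = x * _
  rw [hrs, div_mul_cancel₀ _ hs]

/-! ### Degree of a polynomial curve -/

/-- The pullback `a₀ + a₁ q₁(t) + a₂ q₂(t) + a₃ q₃(t)` of a plane to the parameter line. -/
noncomputable def planeSection {R : Type*} [CommRing R] (q : Fin 3 → R[X]) (a : Fin 4 → R) : R[X] :=
  C (a 0) + C (a 1) * q 0 + C (a 2) * q 1 + C (a 3) * q 2

theorem map_planeSection {R S : Type*} [CommRing R] [CommRing S] (φ : R →+* S) (q : Fin 3 → R[X])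
    (a : Fin 4 → R) :
    (planeSection q a).map φ = planeSection (fun k => (q k).map φ) (fun i => φ (a i)) := by
  simp [planeSection]

theorem natDegree_planeSection_le {R : Type*} [CommRing R] {q : Fin 3 → R[X]} {n : ℕ}
    (hq : ∀ k, (q k).natDegree ≤ n) (a : Fin 4 → R) : (planeSection q a).natDegree ≤ n := by
  have h : ∀ k (c : R), (C c * q k).natDegree ≤ n := fun k c ↦
    (natDegree_C_mul_le _ _).trans (hq k)
  refine natDegree_add_le_of_degree_le (natDegree_add_le_of_degree_le
    (natDegree_add_le_of_degree_le ?_ (h _ _)) (h _ _)) (h _ _)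
  simp

theorem hasDegree_polyCurve {q : Fin 3 → ℂ[X]} {n : ℕ} (hn : 0 < n) (h0 : q 0 = X ^ n)
    (hdeg : ∀ k, (q k).natDegree ≤ n) (hproper : IsProperParam q) : HasDegree (polyCurve q) n := by
  obtain ⟨u, v, hv, huv⟩ := hproper
  -- The section by the generic plane, whose coefficients are indeterminates.
  let H := planeSection (fun k => (q k).map (MvPolynomial.C (σ := Fin 4))) MvPolynomial.X
  have hH : ∀ a : Fin 4 → ℂ, H.map (MvPolynomial.eval a) = planeSection q a := fun a ↦ by
    rw [map_planeSection]
    congr 1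
    · funext k
      exact Polynomial.ext fun i ↦ by rw [coeff_map, coeff_map, MvPolynomial.eval_C]
    · simp
  -- Genericity means: simple roots (`G₁`), degree exactly `n` (`G₂`), and no root at a zero of
  -- `v(q(t))`, where the inverse is undefined (`G₃`). The formal degrees `n`, `n - 1` let the
  -- resultant commute with specialization even if degrees drop.
  let G₁ := resultant H (derivative H) n (n - 1)
  let G₂ := H.coeff n
  let G₃ := ∏ t ∈ (MvPolynomial.aeval q v).roots.toFinset, H.eval (MvPolynomial.C t)
  have hG₁ : ∀ a, MvPolynomial.eval a G₁ =
      resultant (planeSection q a) (derivative (planeSection q a)) n (n - 1) := fun a ↦ by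
    rw [← hH, derivative_map, resultant_map_map]
  have hG₂ : ∀ a, MvPolynomial.eval a G₂ = (planeSection q a).coeff n := fun a ↦ by
    rw [← hH, coeff_map]
  have hG₃ : ∀ (a : Fin 4 → ℂ) (t : ℂ), MvPolynomial.eval a (H.eval (MvPolynomial.C t)) =
      (planeSection q a).eval t := fun a t ↦ by
    rw [← hH, ← MvPolynomial.eval_C (f := a) t, ← Polynomial.eval_map_apply]
    simp
  -- The plane `x₁ = 1` shows that `G₁` and `G₂` are nonzero.
  have hev : planeSection q ![-1, 1, 0, 0] = X ^ n - C 1 := by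
    simp [planeSection, h0]; ring
  have hG₁0 : G₁ ≠ 0 := fun h ↦ by
    have h1 := hG₁ ![-1, 1, 0, 0]
    have hnd : (X ^ n - C 1 : ℂ[X]).natDegree = n := natDegree_X_pow_sub_C
    have hnd' : (derivative (X ^ n - C 1 : ℂ[X])).natDegree = n - 1 := by
      rw [natDegree_derivative, hnd]
    rw [h, map_zero, hev] at h1
    have hsep : (X ^ n - C 1 : ℂ[X]).Separable :=
      separable_X_pow_sub_C 1 (Nat.cast_ne_zero.2 hn.ne') one_ne_zero
    refine resultant_ne_zero _ _ hsep ?_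
    rw [hnd, hnd', ← h1]
  have hG₂0 : G₂ ≠ 0 := fun h ↦ by
    have h1 := hG₂ ![-1, 1, 0, 0]
    rw [h, map_zero, hev] at h1
    simp [coeff_one, hn.ne'] at h1
  have hG₃0 : G₃ ≠ 0 := by
    refine Finset.prod_ne_zero_iff.2 fun t _ h ↦ ?_
    have h1 := hG₃ ![1, 0, 0, 0] t
    rw [h, map_zero] at h1
    simp [planeSection] at h1
  refine ⟨G₁ * G₂ * G₃, mul_ne_zero (mul_ne_zero hG₁0 hG₂0) hG₃0, fun a ha ↦ ?_⟩
  rw [map_mul, map_mul] at ha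
  have ha₁ := left_ne_zero_of_mul (left_ne_zero_of_mul ha)
  have ha₂ := right_ne_zero_of_mul (left_ne_zero_of_mul ha)
  have ha₃ := right_ne_zero_of_mul ha
  set h := planeSection q a with hh
  rw [hG₁] at ha₁
  rw [hG₂] at ha₂
  have hle : h.natDegree ≤ n := natDegree_planeSection_le hdeg a
  have hnd : h.natDegree = n := le_antisymm hle (le_natDegree_of_ne_zero ha₂)
  have hsep : h.Separable := by
    obtain ⟨p, r, -, -, hpr⟩ := exists_mul_add_mul_eq_C_resultant h (derivative h) hle
      ((natDegree_derivative_le h).trans (Nat.sub_le_sub_right hle 1)) (Or.inl hn.ne')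
    set c := resultant h (derivative h) n (n - 1)
    refine ⟨C c⁻¹ * p, C c⁻¹ * r, ?_⟩
    calc C c⁻¹ * p * h + C c⁻¹ * r * derivative h = C c⁻¹ * (h * p + derivative h * r) := by ring
      _ = 1 := by rw [hpr, ← C_mul, inv_mul_cancel₀ ha₁, C_1]
  have hroots : ∀ t, h.eval t = 0 → (MvPolynomial.aeval q v).eval t ≠ 0 := fun t ht hvt ↦ by
    refine ha₃ ?_
    rw [map_prod]
    refine Finset.prod_eq_zero (i := t) ?_ ((hG₃ a t).trans ht)
    rw [Multiset.mem_toFinset]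
    exact mem_roots'.2 ⟨hv, hvt⟩
  have hset : {p ∈ polyCurve q | a 0 + a 1 * p 0 + a 2 * p 1 + a 3 * p 2 = 0} =
      (fun t : ℂ => fun k => (q k).eval t) '' (h.roots.toFinset : Set ℂ) := by
    have hne : h ≠ 0 := fun h' ↦ ha₂ (by rw [← hh, h', coeff_zero])
    have hmem : ∀ t, t ∈ (h.roots.toFinset : Set ℂ) ↔
        a 0 + a 1 * (q 0).eval t + a 2 * (q 1).eval t + a 3 * (q 2).eval t = 0 := fun t ↦ by
      rw [Finset.mem_coe, Multiset.mem_toFinset, mem_roots hne]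
      simp [hh, planeSection]
    ext p
    constructor
    · rintro ⟨⟨t, rfl⟩, ht⟩
      exact ⟨t, (hmem t).2 ht, rfl⟩
    · rintro ⟨t, ht, rfl⟩
      exact ⟨⟨t, rfl⟩, (hmem t).1 ht⟩
  have hinj : Set.InjOn (fun t : ℂ => fun k => (q k).eval t) (h.roots.toFinset : Set ℂ) := by
    intro s hs t ht hst
    have hs' : h.eval s = 0 := (mem_roots'.1 (Multiset.mem_toFinset.1 hs)).2
    have huv' : ∀ w, (MvPolynomial.aeval q u).eval w = w * (MvPolynomial.aeval q v).eval w :=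
      fun w ↦ by rw [huv, eval_mul, eval_X]
    have h1 := huv' s
    have h2 := huv' t
    have hst' : (fun k => (q k).eval s) = fun k => (q k).eval t := hst
    have hvs := hroots s hs'
    rw [eval_aeval_triple, eval_aeval_triple, hst'] at h1
    rw [eval_aeval_triple, eval_aeval_triple, h1] at h2
    rw [eval_aeval_triple, hst'] at hvs
    exact mul_right_cancel₀ hvs h2
  rw [hset, hinj.encard_image, Set.encard_coe_eq_coe_finsetCard,
    Multiset.toFinset_card_of_nodup (nodup_roots hsep),
    ← (IsAlgClosed.splits h).natDegree_eq_card_roots, hnd]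

/-! ### Denominators and truncation of Puiseux series -/

namespace PuiseuxSeries

open Classical in
theorem ramificationIndex_pos (φ : PuiseuxSeries) : 0 < φ.ramificationIndex := by
  exact (Nat.find_spec φ.exists_ramification).1

-- The gcd of two common denominators is again one, so the least one divides all others.
open Classical in
theorem ramificationIndex_dvd (φ : PuiseuxSeries) {N : ℕ} (hN : 0 < N)
    (h : ∀ q, φ.coeff q ≠ 0 → ∃ i : ℕ, q = i / N) : φ.ramificationIndex ∣ N := by
  set R := φ.ramificationIndex with hR
  have hR0 : 0 < R := φ.ramificationIndex_pos
  have hspec : ∀ q, φ.coeff q ≠ 0 → ∃ i : ℕ, q = i / R :=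
    (Nat.find_spec φ.exists_ramification).2
  have hg : 0 < Nat.gcd R N := Nat.gcd_pos_of_pos_left _ hR0
  have hle : R ≤ Nat.gcd R N := by
    refine Nat.find_min' φ.exists_ramification ⟨hg, fun q hq ↦ ?_⟩
    obtain ⟨i, hi⟩ := hspec q hq
    obtain ⟨j, hj⟩ := h q hq
    obtain ⟨a, b, hab, ha, hb⟩ := Nat.exists_coprime R N
    have hR' : (R : ℚ) ≠ 0 := by positivity
    have hN' : (N : ℚ) ≠ 0 := by positivity
    have hij : i * b = j * a := by
      have h1 : (i : ℚ) * N = j * R := by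
        rw [hi, div_eq_div_iff hR' hN'] at hj
        exact hj
      have h2 : i * N = j * R := by exact_mod_cast h1
      refine Nat.eq_of_mul_eq_mul_right hg ?_
      rw [mul_assoc, mul_assoc, ← ha, ← hb, h2]
    obtain ⟨k, rfl⟩ : a ∣ i := hab.dvd_of_dvd_mul_right ⟨j, by rw [hij, mul_comm]⟩
    refine ⟨k, ?_⟩
    have ha0 : (a : ℚ) ≠ 0 := by
      rintro h0
      rw [Nat.cast_eq_zero.1 h0, zero_mul] at ha
      omega
    have hR'' : (R : ℚ) = a * (Nat.gcd R N : ℕ) := by exact_mod_cast ha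
    rw [hi, hR'', Nat.cast_mul, mul_div_mul_left _ _ ha0]
  exact (le_antisymm (Nat.gcd_le_left _ hR0) hle) ▸ Nat.gcd_dvd_right R N

open Classical in
theorem exists_eq_div_of_ramificationIndex_dvd (φ : PuiseuxSeries) {N : ℕ} (hN : 0 < N)
    (h : φ.ramificationIndex ∣ N) {q : ℚ} (hq : φ.coeff q ≠ 0) : ∃ i : ℕ, q = i / N := by
  obtain ⟨i, hi⟩ := (Nat.find_spec φ.exists_ramification).2 q hq
  change q = i / φ.ramificationIndex at hi
  obtain ⟨c, rfl⟩ := h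
  have hc : (c : ℚ) ≠ 0 := by
    rintro h0
    rw [Nat.cast_eq_zero.1 h0, mul_zero] at hN
    exact hN.false
  exact ⟨i * c, by rw [hi, Nat.cast_mul, Nat.cast_mul, mul_div_mul_right _ _ hc]⟩

theorem coeff_trunc (φ : PuiseuxSeries) (q : ℚ) :
    φ.trunc.coeff q = if q ≤ 1 then φ.coeff q else 0 := rfl

theorem trunc_value_eq_sum (φ : PuiseuxSeries) {n : ℕ} (hn : 0 < n) (s : ℂ) :
    φ.trunc.value n s = ∑ j ∈ Finset.range (n + 1), φ.coeff ((j : ℚ) / n) * s ^ j := by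
  have hn' : (0 : ℚ) < n := Nat.cast_pos.2 hn
  have hle : ∀ j : ℕ, (j : ℚ) / n ≤ 1 ↔ j ∈ Finset.range (n + 1) := fun j ↦ by
    rw [div_le_one hn', Nat.cast_le, Finset.mem_range, Nat.lt_succ_iff]
  rw [value, tsum_eq_sum (s := Finset.range (n + 1))]
  · exact Finset.sum_congr rfl fun j hj ↦ by rw [coeff_trunc, if_pos ((hle j).2 hj)]
  · exact fun j hj ↦ by rw [coeff_trunc, if_neg (mt (hle j).1 hj), zero_mul]

end PuiseuxSeries

open InfinityBranch PuiseuxSeries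

theorem pow_mul_trunc_value (φ : PuiseuxSeries) {n : ℕ} (hn : 0 < n) {t : ℂ} (ht : t ≠ 0) :
    t ^ n * φ.trunc.value n t⁻¹ = (truncPoly φ n).eval t := by
  rw [φ.trunc_value_eq_sum hn, truncPoly, eval_finsetSum, Finset.mul_sum]
  refine Finset.sum_congr rfl fun j hj ↦ ?_
  rw [eval_monomial, pow_sub₀ _ ht (Nat.lt_succ_iff.1 (Finset.mem_range.1 hj)), inv_pow]
  ring

theorem natDegree_truncPoly_le (φ : PuiseuxSeries) (n : ℕ) : (truncPoly φ n).natDegree ≤ n :=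
  natDegree_sum_le_of_forall_le _ _ fun j _ ↦
    (natDegree_monomial_le _).trans (Nat.sub_le n j)

theorem coeff_truncPoly (φ : PuiseuxSeries) {n j : ℕ} (hj : j ≤ n) :
    (truncPoly φ n).coeff (n - j) = φ.coeff ((j : ℚ) / n) := by
  rw [truncPoly, finsetSum_coeff, Finset.sum_eq_single j]
  · rw [coeff_monomial, if_pos rfl]
  · intro i hi hij
    rw [coeff_monomial, if_neg]
    have := Finset.mem_range.1 hi
    omega
  · exact fun h ↦ absurd (Finset.mem_range.2 (Nat.lt_succ_iff.2 hj)) h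

/-- If replacing `t` by `ε t` fixes the truncation, then `orderOf ε` divides all numerators. -/
theorem ramificationIndex_trunc_dvd_of_comp_eq (φ : PuiseuxSeries) {n : ℕ} (hn : 0 < n)
    (hφ : φ.trunc.ramificationIndex ∣ n) {ε : ℂ} (hε : ε ^ n = 1)
    (h : (truncPoly φ n).comp (C ε * X) = truncPoly φ n) :
    φ.trunc.ramificationIndex ∣ n / orderOf ε := by
  have hd : orderOf ε ∣ n := orderOf_dvd_of_pow_eq_one hε
  have hd0 : 0 < orderOf ε := Nat.pos_of_dvd_of_pos hd hn
  refine ramificationIndex_dvd _ (Nat.div_pos (Nat.le_of_dvd hn hd) hd0) fun q hq ↦ ?_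
  obtain ⟨j, rfl⟩ := exists_eq_div_of_ramificationIndex_dvd _ hn hφ hq
  have hn' : (0 : ℚ) < n := Nat.cast_pos.2 hn
  have hq1 : (j : ℚ) / n ≤ 1 := by
    by_contra h'
    exact hq (if_neg h')
  have hjn : j ≤ n := by rwa [div_le_one hn', Nat.cast_le] at hq1
  have hc : φ.coeff ((j : ℚ) / n) ≠ 0 := by rwa [coeff_trunc, if_pos hq1] at hq
  have h1 := congrArg (Polynomial.coeff · (n - j)) h
  simp only [comp_C_mul_X_coeff, coeff_truncPoly φ hjn] at h1
  -- The order of `ε` divides both `n` and `n - j`, so it cancels from `j / n`.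
  have h2 : ε ^ (n - j) = 1 := mul_left_cancel₀ hc (h1.trans (mul_one _).symm)
  have h3 : orderOf ε ∣ j := by
    have := Nat.dvd_sub hd (orderOf_dvd_of_pow_eq_one h2)
    rwa [Nat.sub_sub_self hjn] at this
  obtain ⟨i, hi⟩ := h3
  obtain ⟨m, hm⟩ := hd
  refine ⟨i, ?_⟩
  have hd' : (orderOf ε : ℚ) ≠ 0 := Nat.cast_ne_zero.2 hd0.ne'
  rw [hm, Nat.mul_div_cancel_left _ hd0, hi, Nat.cast_mul, Nat.cast_mul, mul_div_mul_left _ _ hd']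

theorem pairIndex_pos (φ₂ φ₃ : PuiseuxSeries) : 0 < pairIndex φ₂ φ₃ :=
  Nat.lcm_pos φ₂.ramificationIndex_pos φ₃.ramificationIndex_pos

/-! ### The truncated branch and its parametrization -/

namespace InfinityBranch

variable {C₀ : Set (Fin 3 → ℂ)} (B : InfinityBranch C₀)

theorem degree_pos : 0 < B.degree := pairIndex_pos _ _

theorem natDegree_param_le (k : Fin 3) : (B.param k).natDegree ≤ B.degree := by
  fin_cases k
  · exact natDegree_X_pow_le _
  · exact natDegree_truncPoly_le _ _
  · exact natDegree_truncPoly_le _ _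

theorem paramDegree_param : paramDegree B.param = B.degree :=
  le_antisymm (Finset.sup_le fun k _ ↦ B.natDegree_param_le k)
    ((natDegree_X_pow B.degree).symm.le.trans
      (Finset.le_sup (f := fun k => (B.param k).natDegree) (Finset.mem_univ 0)))

/-- If `ε` of order `d` fixes the triple, both ramification indices divide `n / d`, hence so does
their lcm `n`, forcing `d = 1`. -/
theorem isProperParam_param : IsProperParam B.param := by
  refine isProperParam_of_comp_eq B.degree_pos rfl fun ε hε h ↦ ?_
  have h₂ := ramificationIndex_trunc_dvd_of_comp_eq B.φ₂ B.degree_pos (Nat.dvd_lcm_left _ _) hε (h 1)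
  have h₃ := ramificationIndex_trunc_dvd_of_comp_eq B.φ₃ B.degree_pos (Nat.dvd_lcm_right _ _) hε (h 2)
  have hdvd : B.degree ∣ B.degree / orderOf ε := Nat.lcm_dvd h₂ h₃
  have hd : orderOf ε ∣ B.degree := orderOf_dvd_of_pow_eq_one hε
  have hd0 : 0 < orderOf ε := Nat.pos_of_dvd_of_pos hd B.degree_pos
  have hpos := Nat.div_pos (Nat.le_of_dvd B.degree_pos hd) hd0
  rw [← orderOf_eq_one_iff]
  by_contra hne
  exact absurd (Nat.le_of_dvd hpos hdvd)
    (not_le.2 (Nat.div_lt_self B.degree_pos (by omega)))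

theorem point_eq_eval_param {t : ℂ} (ht : t ≠ 0) :
    ![t ^ B.degree, t ^ B.degree * B.φ₂.trunc.value B.degree t⁻¹,
      t ^ B.degree * B.φ₃.trunc.value B.degree t⁻¹] = fun k => (B.param k).eval t := by
  rw [pow_mul_trunc_value _ B.degree_pos ht, pow_mul_trunc_value _ B.degree_pos ht]
  funext k
  fin_cases k <;> simp [param]

theorem truncated_subset_polyCurve {M' : ℝ} (hM' : 0 < M') : B.truncated M' ⊆ polyCurve B.param := by
  intro p hp
  obtain ⟨ε, hε, z, hz, rfl⟩ := Set.mem_iUnion₂.1 hp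
  change ε ^ B.degree = 1 at hε
  have hz0 : z ≠ 0 := norm_pos_iff.1 (hM'.trans hz)
  change ![z, z * B.φ₂.trunc.value B.degree (ε * z⁻¹ ^ ((B.degree : ℂ)⁻¹)),
    z * B.φ₃.trunc.value B.degree (ε * z⁻¹ ^ ((B.degree : ℂ)⁻¹))] ∈ _
  set s := ε * z⁻¹ ^ ((B.degree : ℂ)⁻¹) with hs
  have hsn : s ^ B.degree = z⁻¹ := by
    rw [hs, mul_pow, hε, one_mul, Complex.cpow_nat_inv_pow _ B.degree_pos.ne']
  have hs0 : s ≠ 0 := by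
    rintro h
    rw [h, zero_pow B.degree_pos.ne'] at hsn
    exact inv_ne_zero hz0 hsn.symm
  have hz' : z = s⁻¹ ^ B.degree := by rw [inv_pow, hsn, inv_inv]
  -- The parameter is the inverse of the `n`-th root of `1 / z` chosen by the leaf.
  refine ⟨s⁻¹, ?_⟩
  change (fun k => (B.param k).eval s⁻¹) = _
  rw [← B.point_eq_eval_param (inv_ne_zero hs0), ← hz', inv_inv]

theorem eval_param_mem_truncated {M' : ℝ} {t : ℂ} (ht0 : t ≠ 0) (ht : M' < ‖t ^ B.degree‖) :
    (fun k => (B.param k).eval t) ∈ B.truncated M' := by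
  set z := t ^ B.degree with hz
  have hz0 : z ≠ 0 := pow_ne_zero _ ht0
  set w := z⁻¹ ^ ((B.degree : ℂ)⁻¹) with hw
  have hwn : w ^ B.degree = z⁻¹ := Complex.cpow_nat_inv_pow _ B.degree_pos.ne'
  have hw0 : w ≠ 0 := by
    rintro h
    rw [h, zero_pow B.degree_pos.ne'] at hwn
    exact inv_ne_zero hz0 hwn.symm
  -- The leaf is selected by the ratio of `t⁻¹` to the principal `n`-th root of `1 / z`.
  refine Set.mem_iUnion₂.2 ⟨t⁻¹ / w, ?_, z, ht, ?_⟩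
  · change (t⁻¹ / w) ^ B.degree = 1
    rw [div_pow, hwn, inv_pow, ← hz, div_self (inv_ne_zero hz0)]
  · change _ = ![z, z * B.φ₂.trunc.value B.degree (t⁻¹ / w * w),
      z * B.φ₃.trunc.value B.degree (t⁻¹ / w * w)]
    rw [div_mul_cancel₀ _ hw0, hz, B.point_eq_eval_param ht0]

theorem infinite_eval_param_mem_truncated (M' : ℝ) :
    {t : ℂ | (fun k => (B.param k).eval t) ∈ B.truncated M'}.Infinite := by
  -- These real parameters are at least `1` and exceed `M'`, so their `n`-th powers do too.
  have hinj : Function.Injective fun m : ℕ => ((m : ℂ) + (max M' 0 + 1 : ℝ)) := fun a b hab ↦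
    Nat.cast_injective (add_right_cancel hab)
  refine (Set.infinite_range_of_injective hinj).mono ?_
  rintro _ ⟨m, rfl⟩
  have hx : 1 ≤ (m : ℝ) + (max M' 0 + 1) := by
    have := le_max_right M' 0
    have : (0 : ℝ) ≤ m := Nat.cast_nonneg m
    linarith
  have hnorm : ‖(m : ℂ) + (max M' 0 + 1 : ℝ)‖ = m + (max M' 0 + 1) := by
    rw [← Complex.ofReal_natCast, ← Complex.ofReal_add, Complex.norm_real,
      Real.norm_of_nonneg (zero_le_one.trans hx)]
  refine B.eval_param_mem_truncated ?_ ?_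
  · exact norm_pos_iff.1 (by rw [hnorm]; linarith)
  · rw [norm_pow, hnorm]
    refine lt_of_lt_of_le ?_ (le_self_pow₀ hx B.degree_pos.ne')
    have := le_max_left M' 0
    have : (0 : ℝ) ≤ m := Nat.cast_nonneg m
    linarith

end InfinityBranch

end SpaceAsymptote

end

open SpaceAsymptote in
theorem mainTheorem7 (C : Set (Fin 3 → ℂ)) (hC : IsIrreducibleCurve C) (B : InfinityBranch C)
    (M' : ℝ) (hM' : 0 < M') :
    ∃ C' : Set (Fin 3 → ℂ), IsIrreducibleCurve C' ∧ B.truncated M' ⊆ C' ∧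
      (∀ D : Set (Fin 3 → ℂ), IsIrreducibleCurve D → B.truncated M' ⊆ D → D = C') ∧
      IsParametrization B.param C' ∧ IsProperParam B.param ∧ paramDegree B.param = B.degree ∧
      HasDegree C' B.degree := by
  refine ⟨polyCurve B.param, isIrreducibleCurve_polyCurve B.degree_pos rfl,
    B.truncated_subset_polyCurve hM', fun D hD hBD ↦ ?_, ⟨fun t ↦ ⟨t, rfl⟩, ?_⟩,
    B.isProperParam_param, B.paramDegree_param,
    hasDegree_polyCurve B.degree_pos rfl B.natDegree_param_le B.isProperParam_param⟩
  · exact eq_polyCurve_of_infinite B.degree_pos rfl hD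
      ((B.infinite_eval_param_mem_truncated M').mono fun t ht ↦ hBD ht)
  -- The curve is the image itself, so no point is missed.
  · rw [polyCurve, Set.sdiff_self]
    exact Set.finite_empty
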